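/- Let $\mathbb K\in\{\mathbb R,\mathbb C\}$, $m\ge 0$, and let $X^*$ be the set of words in the noncommuting letters $x_0,x_1,\dots,x_m$. Let $\mathbb K^m\langle\langle X\rangle\rangle$ be the space of all maps $c\colon X^*\to\mathbb K^m$, $\eta\mapsto(c,\eta)$, with the Fréchet topology of $\prod_{\eta\in X^*}\mathbb K^m$. For $d\in\mathbb K^m\langle\langle X\rangle\rangle$ with component series $d[1],\dots,d[m]$, and $d[0]:=0$, let $\phi_d(x_i)(e)=x_ie+x_0(d[i]\sqcup\!\sqcup\, e)$ for $e\in\mathbb K\langle\langle X\rangle\rangle$, where $\sqcup\!\sqcup$ is the shuffle product; let $\phi_d(x_{i_1}\cdots x_{i_k})=\phi_d(x_{i_1})\circ\cdots\circ\phi_d(x_{i_k})$ and $\phi_d(\emptyset)=\mathrm{id}$. With a formal symbol $\delta$, define on the set $\delta+\mathbb K^m\langle\langle X\rangle\rangle$ the product $$(\delta+c)\circ(\delta+d)=\delta+d+\sum_{\eta\in X^*}(c,\eta)\,\phi_d(\eta)(\mathbf 1),\qquad \mathbf 1=1\emptyset .$$ Then $(\delta+\mathbb K^m\langle\langle X\rangle\rangle,\circ,\delta)$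 is a group and, with the topology and the manifold structure given by the global chart $\delta+c\mapsto c$ into the Fréchet space $\mathbb K^m\langle\langle X\rangle\rangle$, it is a $\mathbb K$-analytic Lie group, i.e. multiplication and inversion are analytic. Here a map between open subsets of complex locally convex spaces is (complex) analytic if it is continuous, all its iterated complex directional derivatives exist, and they are jointly continuous in the point and the directions; a map between open subsets of real locally convex spaces is (real) analytic if it extends to a complex analytic map on an open neighbourhood of its domain in the complexification. Moreover, every coordinate $(\cdot,\eta)_i$ ($\eta\in X^*$, $1\le i\le m$) of the product and of the inverse is a polynomial over $\mathbb K$ in finitely many coordinates of the arguments. -/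

import Mathlib

open Set Filter Topology

namespace ChenFliess

/-! ### Calculus on locally convex spaces -/

section Calculus

universe u

/-- `f` has the directional derivative `f'` at `x` in direction `y`. -/
def HasDirDeriv (𝕜 : Type*) [NontriviallyNormedField 𝕜]
    {E F : Type*} [AddCommGroup E] [Module 𝕜 E]
    [AddCommGroup F] [Module 𝕜 F] [TopologicalSpace F]
    (f : E → F) (f' : F) (x y : E) : Prop :=
  Tendsto (fun t : 𝕜 => t⁻¹ • (f (x + t • y) - f x)) (𝓝[≠] 0) (𝓝 f')

/-- `f` is of class `C^r_𝕜` on the open set `U` (`r ∈ {0, 1, 2, …, ∞}`): `f` is continuous on `U`,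
the iterated directional derivatives
`d^k f (x, y₁, …, y_k) = (D_{y_k} ⋯ D_{y₁} f) (x)` exist for `k ≤ r`, and they are
continuous on `U × E^k`. The function `D k` is `d^k f`; the case `k = 0` of the last clause is
the continuity of `f`. -/
def IsCrOn (𝕜 : Type*) [NontriviallyNormedField 𝕜] (r : ℕ∞)
    {E F : Type*} [AddCommGroup E] [Module 𝕜 E] [TopologicalSpace E]
    [AddCommGroup F] [Module 𝕜 F] [TopologicalSpace F]
    (f : E → F) (U : Set E) : Prop :=
  IsOpen U ∧ ∃ D : (k : ℕ) → E → (Fin k → E) → F,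
    (∀ x ∈ U, ∀ y : Fin 0 → E, D 0 x y = f x) ∧
    (∀ k : ℕ, ((k + 1 : ℕ) : ℕ∞) ≤ r → ∀ x ∈ U, ∀ (y : Fin k → E) (w : E),
      HasDirDeriv 𝕜 (fun z => D k z y) (D (k + 1) x (Fin.snoc (α := fun _ => E) y w)) x w) ∧
    (∀ k : ℕ, (k : ℕ∞) ≤ r →
      ContinuousOn (fun p : E × (Fin k → E) => D k p.1 p.2) (U ×ˢ univ))

/-- The complexification `E × E` of a real space `E`; the pair `(u, v)` stands for `u + i v`. -/
def Complexification (E : Type*) : Type _ := E × E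

instance (E : Type*) [AddCommGroup E] : AddCommGroup (Complexification E) :=
  inferInstanceAs (AddCommGroup (E × E))

instance (E : Type*) [TopologicalSpace E] : TopologicalSpace (Complexification E) :=
  inferInstanceAs (TopologicalSpace (E × E))

instance (E : Type*) [AddCommGroup E] [Module ℝ E] : SMul ℂ (Complexification E) where
  smul z p := (z.re • p.1 - z.im • p.2, z.re • p.2 + z.im • p.1)

theorem Complexification.smul_eq {E : Type*} [AddCommGroup E] [Module ℝ E]
    (z : ℂ) (p : Complexification E) :
    z • p = (z.re • p.1 - z.im • p.2, z.re • p.2 + z.im • p.1) := rfl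

instance (E : Type*) [AddCommGroup E] [Module ℝ E] : Module ℂ (Complexification E) where
  one_smul p := by
    apply Prod.ext <;> simp [Complexification.smul_eq]
  mul_smul z w p := by
    apply Prod.ext
    · change (z * w).re • p.1 - (z * w).im • p.2 =
        z.re • (w.re • p.1 - w.im • p.2) - z.im • (w.re • p.2 + w.im • p.1)
      rw [Complex.mul_re, Complex.mul_im]
      module
    · change (z * w).re • p.2 + (z * w).im • p.1 =
        z.re • (w.re • p.2 + w.im • p.1) + z.im • (w.re • p.1 - w.im • p.2)
      rw [Complex.mul_re, Complex.mul_im]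
      module
  smul_zero z := by
    apply Prod.ext
    · change z.re • (0 : E) - z.im • (0 : E) = 0
      simp
    · change z.re • (0 : E) + z.im • (0 : E) = 0
      simp
  smul_add z p q := by
    apply Prod.ext
    · change z.re • (p.1 + q.1) - z.im • (p.2 + q.2) =
        (z.re • p.1 - z.im • p.2) + (z.re • q.1 - z.im • q.2)
      module
    · change z.re • (p.2 + q.2) + z.im • (p.1 + q.1) =
        (z.re • p.2 + z.im • p.1) + (z.re • q.2 + z.im • q.1)
      module
  add_smul z w p := by
    apply Prod.ext
    · change (z.re + w.re) • p.1 - (z.im + w.im) • p.2 =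
        (z.re • p.1 - z.im • p.2) + (w.re • p.1 - w.im • p.2)
      module
    · change (z.re + w.re) • p.2 + (z.im + w.im) • p.1 =
        (z.re • p.2 + z.im • p.1) + (w.re • p.2 + w.im • p.1)
      module
  zero_smul p := by
    apply Prod.ext
    · change (0 : ℝ) • p.1 - (0 : ℝ) • p.2 = 0
      simp
    · change (0 : ℝ) • p.2 + (0 : ℝ) • p.1 = 0
      simp

/-- The inclusion `u ↦ u + i 0` of a real space in its complexification. -/
def Complexification.incl {E : Type*} [AddCommGroup E] (x : E) : Complexification E := (x, 0)

/-- Complex analytic (holomorphic) maps, i.e. maps of class `C^∞_ℂ`. -/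
def IsComplexAnalyticOn (E F : Type u) [AddCommGroup E] [Module ℂ E] [TopologicalSpace E]
    [AddCommGroup F] [Module ℂ F] [TopologicalSpace F] (f : E → F) (U : Set E) : Prop :=
  IsCrOn ℂ ⊤ f U

/-- Real analytic maps: those that extend to a complex analytic map on an open neighbourhood
of `U` in the complexification. -/
def IsRealAnalyticOn (E F : Type u) [AddCommGroup E] [Module ℝ E] [TopologicalSpace E]
    [AddCommGroup F] [Module ℝ F] [TopologicalSpace F] (f : E → F) (U : Set E) : Prop :=
  IsOpen U ∧ ∃ (V : Set (Complexification E)) (g : Complexification E → Complexification F),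
    IsComplexAnalyticOn (Complexification E) (Complexification F) g V ∧
    ∀ x ∈ U, Complexification.incl x ∈ V ∧
      g (Complexification.incl x) = Complexification.incl (f x)

/-- A class of maps between open subsets of topological `𝕜`-vector spaces, such as the
real analytic maps or the complex analytic maps. -/
abbrev MapClass (𝕜 : Type*) [Field 𝕜] : Type _ :=
  ∀ (E F : Type u) [AddCommGroup E] [Module 𝕜 E] [TopologicalSpace E]
    [AddCommGroup F] [Module 𝕜 F] [TopologicalSpace F], (E → F) → Set E → Prop

/-- `M` is a Hausdorff manifold modelled on `E`, with changes of charts in the class `A`. -/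
def IsManifoldOf {𝕜 : Type*} [Field 𝕜] (A : MapClass.{u} 𝕜) (E : Type u) [AddCommGroup E]
    [Module 𝕜 E] [TopologicalSpace E] (M : Type*) [TopologicalSpace M] [ChartedSpace E M] : Prop :=
  T2Space M ∧ ∀ e ∈ atlas E M, ∀ e' ∈ atlas E M, A E E (e.symm.trans e') (e.symm.trans e').source

/-- `f : M → N` is a map of class `A` between manifolds modelled on `E` and `F`: it is continuous
and all its expressions in charts are of class `A`. -/
def IsManifoldMap {𝕜 : Type*} [Field 𝕜] (A : MapClass.{u} 𝕜)
    (E : Type u) [AddCommGroup E] [Module 𝕜 E] [TopologicalSpace E]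
    (F : Type u) [AddCommGroup F] [Module 𝕜 F] [TopologicalSpace F]
    {M : Type*} [TopologicalSpace M] [ChartedSpace E M]
    {N : Type*} [TopologicalSpace N] [ChartedSpace F N] (f : M → N) : Prop :=
  Continuous f ∧ ∀ e ∈ atlas E M, ∀ e' ∈ atlas F N,
    A E F (e' ∘ f ∘ e.symm) (e.target ∩ e.symm ⁻¹' (f ⁻¹' e'.source))

/-- The product manifold `M × N`, modelled on `E × F`, with the products of charts as charts. -/
abbrev prodManifold (E F : Type*) [TopologicalSpace E] [TopologicalSpace F]
    (M N : Type*) [TopologicalSpace M] [TopologicalSpace N] [ChartedSpace E M] [ChartedSpace F N] :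
    ChartedSpace (E × F) (M × N) :=
  prodChartedSpace E M F N

/-- `G` is a Lie group of class `A` modelled on `E`: a manifold of class `A` whose multiplication
and inversion are maps of class `A`. -/
def IsLieGroupOf {𝕜 : Type*} [Field 𝕜] (A : MapClass.{u} 𝕜) (E : Type u) [AddCommGroup E]
    [Module 𝕜 E] [TopologicalSpace E]
    (G : Type*) [Group G] [TopologicalSpace G] [ChartedSpace E G] : Prop :=
  letI : ChartedSpace (E × E) (G × G) := prodManifold E E G G
  IsManifoldOf A E G ∧
  IsManifoldMap A (E × E) E (fun p : G × G => p.1 * p.2) ∧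
  IsManifoldMap A E E (fun g : G => g⁻¹)

/-- (Locally convex) real analytic Lie groups. -/
def IsRealAnalyticLieGroup (E : Type u) [AddCommGroup E] [Module ℝ E] [TopologicalSpace E]
    [IsTopologicalAddGroup E] [ContinuousSMul ℝ E] [LocallyConvexSpace ℝ E]
    (G : Type*) [Group G] [TopologicalSpace G] [ChartedSpace E G] : Prop :=
  IsLieGroupOf (𝕜 := ℝ) IsRealAnalyticOn E G

/-- (Locally convex) complex analytic Lie groups. -/
def IsComplexAnalyticLieGroup (E : Type u) [AddCommGroup E] [Module ℂ E] [TopologicalSpace E]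
    [IsTopologicalAddGroup E] [ContinuousSMul ℂ E] [Module ℝ E] [IsScalarTower ℝ ℂ E]
    [LocallyConvexSpace ℝ E]
    (G : Type*) [Group G] [TopologicalSpace G] [ChartedSpace E G] : Prop :=
  IsLieGroupOf (𝕜 := ℂ) IsComplexAnalyticOn E G

end Calculus

/-! ### Formal power series in noncommuting letters `x_0, …, x_m` -/

section Series

/-- Words in the letters `x_0, …, x_m`. -/
abbrev Word (m : ℕ) : Type := List (Fin (m + 1))

/-- `𝕜⟨⟨X⟩⟩`: formal power series with coefficients in `𝕜`. -/
abbrev ScalarSeries (𝕜 : Type*) (m : ℕ) : Type _ := Word m → 𝕜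

/-- `𝕜^l⟨⟨X⟩⟩`: formal power series with coefficients in `𝕜^l`. The instances on function spaces
give it the coefficientwise vector space structure and the product topology of
`∏_η 𝕜^l`, that is, the Fréchet topology. -/
abbrev Series (𝕜 : Type*) (m l : ℕ) : Type _ := Word m → Fin l → 𝕜

/-- The shuffle product of two words, as the list (with multiplicities) of the words that
occur in it. -/
def shuffleWords {m : ℕ} : Word m → Word m → List (Word m)
  | [], ξ => [ξ]
  | i :: η, [] => [i :: η]
  | i :: η, j :: ξ =>
      (shuffleWords η (j :: ξ)).map (List.cons i) ++ (shuffleWords (i :: η) ξ).map (List.cons j)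
  termination_by η ξ => η.length + ξ.length

theorem length_of_mem_shuffleWords {m : ℕ} (η ξ : Word m) :
    ∀ ν ∈ shuffleWords η ξ, ν.length = η.length + ξ.length := by
  induction η, ξ using shuffleWords.induct with
  | case1 ξ => simp [shuffleWords]
  | case2 i η => simp [shuffleWords]
  | case3 i η j ξ ih1 ih2 =>
    intro ν hν
    rw [shuffleWords, List.mem_append, List.mem_map, List.mem_map] at hν
    rcases hν with ⟨μ, hμ, rfl⟩ | ⟨μ, hμ, rfl⟩
    · have := ih1 μ hμ
      simp only [List.length_cons] at *
      omega
    · have := ih2 μ hμ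
      simp only [List.length_cons] at *
      omega

variable {𝕜 : Type*} [Field 𝕜] {m l : ℕ}

/-- The shuffle product of two series, by bilinear extension of the shuffle product of words.
The sum is finite by `shuffle_finite`. -/
noncomputable def shuffle (c d : ScalarSeries 𝕜 m) : ScalarSeries 𝕜 m := fun ν =>
  ∑ᶠ p : Word m × Word m, c p.1 * d p.2 * ((shuffleWords p.1 p.2).count ν : 𝕜)

theorem shuffle_finite (c d : ScalarSeries 𝕜 m) (ν : Word m) :
    (Function.support fun p : Word m × Word m =>
      c p.1 * d p.2 * ((shuffleWords p.1 p.2).count ν : 𝕜)).Finite := by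
  refine ((List.finite_length_le (Fin (m + 1)) ν.length).prod
    (List.finite_length_le (Fin (m + 1)) ν.length)).subset ?_
  intro p hp
  have h : ν ∈ shuffleWords p.1 p.2 := by
    by_contra h
    exact hp (by simp [List.count_eq_zero_of_not_mem h])
  have := length_of_mem_shuffleWords _ _ _ h
  constructor <;> simp only [mem_ofPred_eq] <;> omega

/-- The catenation `x_i e` of a letter and a series. -/
def letterMul (i : Fin (m + 1)) (e : ScalarSeries 𝕜 m) : ScalarSeries 𝕜 m
  | [] => 0
  | j :: η => if j = i then e η else 0

/-- The series `1 = 1∅`. -/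
def oneSeries : ScalarSeries 𝕜 m
  | [] => 1
  | _ :: _ => 0

/-- The component series `d[i]`, `i = 0, …, m`, with the convention `d[0] = 0`. -/
def component (d : Series 𝕜 m m) (i : Fin (m + 1)) : ScalarSeries 𝕜 m := fun η =>
  Fin.cases (motive := fun _ => 𝕜) 0 (fun j => d η j) i

/-- `φ_d(x_i)(e) = x_i e + x_0 (d[i] ⧢ e)`. -/
noncomputable def phiLetter (d : Series 𝕜 m m) (i : Fin (m + 1)) (e : ScalarSeries 𝕜 m) :
    ScalarSeries 𝕜 m :=
  letterMul i e + letterMul 0 (shuffle (component d i) e)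

/-- `φ_d(x_{i_1} ⋯ x_{i_k}) = φ_d(x_{i_1}) ∘ ⋯ ∘ φ_d(x_{i_k})`, and `φ_d(∅)` is the identity. -/
noncomputable def phi (d : Series 𝕜 m m) : Word m → ScalarSeries 𝕜 m → ScalarSeries 𝕜 m
  | [], e => e
  | i :: η, e => phiLetter d i (phi d η e)

theorem phiLetter_eq_zero (d : Series 𝕜 m m) (i : Fin (m + 1)) (e : ScalarSeries 𝕜 m) (k : ℕ)
    (he : ∀ ν : Word m, ν.length < k → e ν = 0) (ν : Word m) (hν : ν.length < k + 1) :
    phiLetter d i e ν = 0 := by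
  have hs : ∀ ν : Word m, ν.length < k → shuffle (component d i) e ν = 0 := by
    intro ν hν
    refine finsum_eq_zero_of_forall_eq_zero fun p => ?_
    by_cases h : ν ∈ shuffleWords p.1 p.2
    · have := length_of_mem_shuffleWords _ _ _ h
      rw [he p.2 (by omega)]
      simp
    · simp [List.count_eq_zero_of_not_mem h]
  cases ν with
  | nil => simp [phiLetter, letterMul]
  | cons j ν =>
    simp only [List.length_cons] at hν
    simp [phiLetter, letterMul, he ν (by omega), hs ν (by omega)]

theorem phi_one_eq_zero (d : Series 𝕜 m m) (η : Word m) :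
    ∀ ν : Word m, ν.length < η.length → phi d η oneSeries ν = 0 := by
  induction η with
  | nil => simp
  | cons i η ih => exact phiLetter_eq_zero d i _ _ ih

/-- The mixed composition product of `c` and `δ + d`, namely `∑_η (c, η) φ_d(η)(1)`.
The sum in each coefficient is finite by `mixedComp_finite`. -/
noncomputable def mixedComp (c : Series 𝕜 m l) (d : Series 𝕜 m m) : Series 𝕜 m l := fun ν i =>
  ∑ᶠ η : Word m, c η i * phi d η oneSeries ν

theorem mixedComp_finite (c : Series 𝕜 m l) (d : Series 𝕜 m m) (ν : Word m) (i : Fin l) :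
    (Function.support fun η : Word m => c η i * phi d η oneSeries ν).Finite := by
  refine (List.finite_length_le (Fin (m + 1)) ν.length).subset ?_
  intro η hη
  by_contra h
  simp only [mem_ofPred_eq, not_le] at h
  exact hη (by simp [phi_one_eq_zero d η ν h])

end Series

/-! ### The unital series `δ + c` -/

/-- The set `δ + 𝕜^m⟨⟨X⟩⟩`; the element `⟨c⟩` is the series `δ + c`, with `δ` a formal symbol. -/
@[ext]
structure UnitalSeries (𝕜 : Type*) (m : ℕ) where
  /-- The series `c` in `δ + c`. -/
  toSeries : Series 𝕜 m m

namespace UnitalSeries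

/-- The bijection `δ + c ↦ c`. -/
def equivSeries (𝕜 : Type*) (m : ℕ) : UnitalSeries 𝕜 m ≃ Series 𝕜 m m where
  toFun := toSeries
  invFun := mk
  left_inv _ := rfl
  right_inv _ := rfl

/-- The Fréchet topology, transported along `δ + c ↦ c`. -/
instance (𝕜 : Type*) [TopologicalSpace 𝕜] (m : ℕ) : TopologicalSpace (UnitalSeries 𝕜 m) :=
  TopologicalSpace.induced (equivSeries 𝕜 m) inferInstance

/-- The homeomorphism `δ + c ↦ c`. -/
def homeoSeries (𝕜 : Type*) [TopologicalSpace 𝕜] (m : ℕ) : UnitalSeries 𝕜 m ≃ₜ Series 𝕜 m m :=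
  (equivSeries 𝕜 m).toHomeomorphOfIsInducing ⟨rfl⟩

/-- The manifold structure on `δ + 𝕜^m⟨⟨X⟩⟩`, given by the single global chart `δ + c ↦ c`. -/
instance (𝕜 : Type*) [TopologicalSpace 𝕜] (m : ℕ) :
    ChartedSpace (Series 𝕜 m m) (UnitalSeries 𝕜 m) :=
  (homeoSeries 𝕜 m).toOpenPartialHomeomorph.singletonChartedSpace rfl

variable {𝕜 : Type*} [Field 𝕜] {m : ℕ}

/-- The unit `δ = δ + 0`. -/
def delta : UnitalSeries 𝕜 m := ⟨0⟩

/-- The product `(δ + c) ∘ (δ + d) = δ + d + (mixed composition of c and δ + d)`. -/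
noncomputable def comp (c d : UnitalSeries 𝕜 m) : UnitalSeries 𝕜 m :=
  ⟨d.toSeries + mixedComp c.toSeries d.toSeries⟩

/-- Every coordinate of the product and of the inverse of a group structure on
`δ + 𝕜^m⟨⟨X⟩⟩` is a polynomial in (finitely many) coordinates of the arguments. -/
def HasPolynomialOperations (𝕜 : Type*) [Field 𝕜] (m : ℕ) [Group (UnitalSeries 𝕜 m)] : Prop :=
  ∀ (η : Word m) (i : Fin m),
    (∃ P : MvPolynomial ((Word m × Fin m) ⊕ (Word m × Fin m)) 𝕜, ∀ c d : UnitalSeries 𝕜 m,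
      (c * d).toSeries η i = MvPolynomial.eval
        (Sum.elim (fun q => c.toSeries q.1 q.2) (fun q => d.toSeries q.1 q.2)) P) ∧
    (∃ Q : MvPolynomial (Word m × Fin m) 𝕜, ∀ c : UnitalSeries 𝕜 m,
      (c⁻¹).toSeries η i = MvPolynomial.eval (fun q => c.toSeries q.1 q.2) Q)

end UnitalSeries

end ChenFliess

/-!
The product on `δ + 𝕜^m⟨⟨X⟩⟩` is `(δ + c) ∘ (δ + d) = δ + d + c ∘̃ (δ + d)`, where `∘̃` acts
componentwise through the linear substitution `subst d : s ↦ s ∘̃ (δ + d)` on scalar series.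

*Group.* The left quotients `s ↦ x_j⁻¹ s` are derivations of the shuffle product (`shuffle_cons`),
so the shuffle algebra is commutative and associative by induction on the length of words, and
`x_j⁻¹ (s ∘̃ (δ + d))` is `(x_j⁻¹ s) ∘̃ (δ + d)`, plus `∑_i d[i] ⧢ ((x_i⁻¹ s) ∘̃ (δ + d))` if
`j = 0` (`subst_cons`). By the same induction `subst d` is an endomorphism of the shuffle algebra
(`subst_shuffle`). Hence `subst e` intertwines `φ_d` with `φ_{d'}`, where
`δ + d' = (δ + d) ∘ (δ + e)` (`subst_phiLetter`), and therefore `subst e ∘ subst d = subst d'`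
(`subst_subst`), which is associativity. A right inverse of `δ + c` is a fixed point of
`d ↦ -(c ∘̃ (δ + d))`; as the coefficients of degree `n` of the right hand side involve `d` only in
degrees `< n` (`subst_congr_left`), iteration from `0` is stationary in each coefficient and yields
the fixed point.

*Polynomial coordinates.* All the sums defining a given coefficient are finite, uniformly in the
arguments, so the coefficients of products, and of the iterates approximating inverses, are
polynomials (`UnitalSeries.hasPolynomialOperations`).

*Analyticity.* On a topological vector space, a polynomial in continuous linear functionals is
continuous, and its directional derivative is again such a polynomial in the point and the
direction; so it is of class `C^∞` (`IsPolynomialFun.isCrOn`). Maps into a product are treated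
coordinatewise. Over `ℝ`, the same polynomials, evaluated at the complex linear extensions of the
functionals, give a complex analytic extension to the complexification
(`isRealAnalyticOn_of_eval`). In the global chart this applies to both group operations.
-/

namespace ChenFliess

/-! ### The shuffle algebra -/

section ShuffleAlgebra

variable {m : ℕ}

/-- The finite set of words of length at most `n`. -/
def wordsLE (m : ℕ) : ℕ → Finset (Word m)
  | 0 => {[]}
  | n + 1 => Finset.cons [] ((Finset.univ ×ˢ wordsLE m n).map
      ⟨fun p : Fin (m + 1) × Word m => p.1 :: p.2, fun p q h => by
        simpa [Prod.ext_iff] using h⟩) (by simp)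

theorem mem_wordsLE {n : ℕ} {η : Word m} : η ∈ wordsLE m n ↔ η.length ≤ n := by
  induction n generalizing η with
  | zero => simp [wordsLE]
  | succ n ih =>
    cases η with
    | nil => simp [wordsLE]
    | cons i η =>
      rw [List.length_cons, add_le_add_iff_right, ← ih, wordsLE, Finset.mem_cons, Finset.mem_map]
      constructor
      · rintro (h | ⟨p, hp, h⟩)
        · cases h
        · cases h
          exact (Finset.mem_product.1 hp).2
      · exact fun h => .inr ⟨(i, η), by simpa using h, rfl⟩

theorem sum_wordsLE_succ {M : Type*} [AddCommMonoid M] (n : ℕ) (f : Word m → M) :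
    ∑ η ∈ wordsLE m (n + 1), f η = f [] + ∑ i, ∑ η ∈ wordsLE m n, f (i :: η) := by
  rw [wordsLE, Finset.sum_cons, Finset.sum_map, Finset.sum_product]
  rfl

/-- The left quotient `x_j⁻¹ c` of a series by a letter. -/
def leftQuot {𝕜 : Type*} (j : Fin (m + 1)) (c : ScalarSeries 𝕜 m) : ScalarSeries 𝕜 m :=
  fun ν => c (j :: ν)

@[simp]
theorem leftQuot_apply {𝕜 : Type*} (j : Fin (m + 1)) (c : ScalarSeries 𝕜 m) (ν : Word m) :
    leftQuot j c ν = c (j :: ν) := rfl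

theorem count_shuffleWords_eq_zero {η ξ ν : Word m} (h : ν.length ≠ η.length + ξ.length) :
    (shuffleWords η ξ).count ν = 0 :=
  List.count_eq_zero_of_not_mem fun hν => h (length_of_mem_shuffleWords _ _ _ hν)

theorem count_cons_map_cons (i j : Fin (m + 1)) (ν : Word m) (L : List (Word m)) :
    (L.map (List.cons i)).count (j :: ν) = if i = j then L.count ν else 0 := by
  split_ifs with h
  · subst h
    exact List.count_map_of_injective _ _ (List.cons_injective) _
  · exact List.count_eq_zero_of_not_mem (by simp [h])

/-- A word `x_j ν` of a shuffle takes its first letter from one of the two factors. -/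
theorem count_cons_shuffleWords (j : Fin (m + 1)) (ν η ξ : Word m) :
    (shuffleWords η ξ).count (j :: ν) =
      (if η.head? = some j then (shuffleWords η.tail ξ).count ν else 0) +
      (if ξ.head? = some j then (shuffleWords η ξ.tail).count ν else 0) := by
  cases η with
  | nil =>
    cases ξ with
    | nil => simp [shuffleWords]
    | cons k ξ => simpa [shuffleWords] using count_cons_map_cons k j ν [ξ]
  | cons i η =>
    cases ξ with
    | nil =>
      have h : shuffleWords η [] = [η] := by cases η <;> simp [shuffleWords]
      simpa [shuffleWords, h] using count_cons_map_cons i j ν [η]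
    | cons k ξ =>
      rw [shuffleWords, List.count_append, count_cons_map_cons, count_cons_map_cons]
      simp

variable {𝕜 : Type*} [Field 𝕜]

theorem shuffle_eq_sum (c d : ScalarSeries 𝕜 m) (ν : Word m) {n k : ℕ} (hn : ν.length ≤ n)
    (hk : ν.length ≤ k) :
    shuffle c d ν = ∑ η ∈ wordsLE m n, ∑ ξ ∈ wordsLE m k,
      c η * d ξ * ((shuffleWords η ξ).count ν : 𝕜) := by
  rw [← Finset.sum_product', shuffle]
  refine finsum_eq_sum_of_support_subset _ fun p hp => ?_
  by_contra h
  refine hp ?_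
  simp only [Finset.coe_product, mem_prod, Finset.mem_coe, mem_wordsLE] at h
  simp only
  rw [count_shuffleWords_eq_zero (by omega), Nat.cast_zero, mul_zero]

theorem shuffle_nil (c d : ScalarSeries 𝕜 m) : shuffle c d [] = c [] * d [] := by
  rw [shuffle_eq_sum c d [] (n := 0) (k := 0) le_rfl le_rfl]
  simp [wordsLE, shuffleWords]

/-- Left quotients are derivations of the shuffle algebra. Together with `shuffle_nil` this
determines the shuffle product. -/
theorem shuffle_cons (c d : ScalarSeries 𝕜 m) (j : Fin (m + 1)) (ν : Word m) :
    shuffle c d (j :: ν) = shuffle (leftQuot j c) d ν + shuffle c (leftQuot j d) ν := by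
  rw [shuffle_eq_sum c d (j :: ν) (n := ν.length + 1) (k := ν.length + 1) (by simp) (by simp),
    shuffle_eq_sum (leftQuot j c) d ν (n := ν.length) (k := ν.length + 1) le_rfl (by simp),
    shuffle_eq_sum c (leftQuot j d) ν (n := ν.length + 1) (k := ν.length) (by simp) le_rfl]
  simp only [count_cons_shuffleWords, Nat.cast_add, mul_add, Finset.sum_add_distrib]
  congr 1
  · rw [sum_wordsLE_succ, Finset.sum_eq_single_of_mem j (Finset.mem_univ _)]
    · simp
    · intro i _ hi
      simp [hi]
  · refine Finset.sum_congr rfl fun η _ => ?_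
    rw [sum_wordsLE_succ, Finset.sum_eq_single_of_mem j (Finset.mem_univ _)]
    · simp
    · intro i _ hi
      simp [hi]

theorem leftQuot_shuffle (c d : ScalarSeries 𝕜 m) (j : Fin (m + 1)) :
    leftQuot j (shuffle c d) = shuffle (leftQuot j c) d + shuffle c (leftQuot j d) :=
  funext fun ν => shuffle_cons c d j ν

theorem shuffle_comm (c d : ScalarSeries 𝕜 m) : shuffle c d = shuffle d c := by
  ext ν
  induction ν generalizing c d with
  | nil => rw [shuffle_nil, shuffle_nil, mul_comm]
  | cons j ν ih => rw [shuffle_cons, shuffle_cons, ih, ih c, add_comm]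

theorem shuffle_add (c d e : ScalarSeries 𝕜 m) :
    shuffle c (d + e) = shuffle c d + shuffle c e := by
  ext ν
  simp only [Pi.add_apply, shuffle_eq_sum _ _ ν le_rfl le_rfl, ← Finset.sum_add_distrib]
  simp only [mul_add, add_mul]

theorem shuffle_smul (a : 𝕜) (c d : ScalarSeries 𝕜 m) :
    shuffle c (a • d) = a • shuffle c d := by
  ext ν
  simp only [Pi.smul_apply, shuffle_eq_sum _ _ ν le_rfl le_rfl, smul_eq_mul, Finset.mul_sum]
  refine Finset.sum_congr rfl fun η _ => Finset.sum_congr rfl fun ξ _ => ?_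
  ring

/-- The shuffle product with a fixed left factor, as a linear map. -/
noncomputable def shuffleLinear (c : ScalarSeries 𝕜 m) :
    ScalarSeries 𝕜 m →ₗ[𝕜] ScalarSeries 𝕜 m where
  toFun := shuffle c
  map_add' := shuffle_add c
  map_smul' a d := shuffle_smul a c d

theorem shuffle_sum {ι : Type*} (s : Finset ι) (c : ScalarSeries 𝕜 m)
    (f : ι → ScalarSeries 𝕜 m) : shuffle c (∑ i ∈ s, f i) = ∑ i ∈ s, shuffle c (f i) :=
  map_sum (shuffleLinear c) f s

theorem shuffle_zero (c : ScalarSeries 𝕜 m) : shuffle c 0 = 0 := map_zero (shuffleLinear c)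

theorem zero_shuffle (c : ScalarSeries 𝕜 m) : shuffle 0 c = 0 := by
  rw [shuffle_comm, shuffle_zero]

theorem add_shuffle (c d e : ScalarSeries 𝕜 m) :
    shuffle (c + d) e = shuffle c e + shuffle d e := by
  rw [shuffle_comm, shuffle_add, shuffle_comm e, shuffle_comm e]

theorem shuffle_assoc (c d e : ScalarSeries 𝕜 m) :
    shuffle (shuffle c d) e = shuffle c (shuffle d e) := by
  ext ν
  induction ν generalizing c d e with
  | nil => simp only [shuffle_nil, mul_assoc]
  | cons j ν ih =>
    simp only [shuffle_cons, leftQuot_shuffle, add_shuffle, shuffle_add, Pi.add_apply, ih]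
    ring

theorem shuffle_left_comm (c d e : ScalarSeries 𝕜 m) :
    shuffle c (shuffle d e) = shuffle d (shuffle c e) := by
  rw [← shuffle_assoc, shuffle_comm c d, shuffle_assoc]

/-- A coefficient of a shuffle product involves no longer words of the factors. -/
theorem shuffle_congr {c c' d d' : ScalarSeries 𝕜 m} {n : ℕ}
    (hc : ∀ η : Word m, η.length ≤ n → c η = c' η)
    (hd : ∀ η : Word m, η.length ≤ n → d η = d' η) {ν : Word m} (hν : ν.length ≤ n) :
    shuffle c d ν = shuffle c' d' ν := by
  rw [shuffle_eq_sum c d ν hν hν, shuffle_eq_sum c' d' ν hν hν]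
  refine Finset.sum_congr rfl fun η hη => Finset.sum_congr rfl fun ξ hξ => ?_
  rw [hc η (mem_wordsLE.1 hη), hd ξ (mem_wordsLE.1 hξ)]

end ShuffleAlgebra

/-! ### The substitution `s ↦ s ∘̃ (δ + d)` and the group `δ + 𝕜^m⟨⟨X⟩⟩` -/

section Substitution

variable {𝕜 : Type*} [Field 𝕜] {m l : ℕ}

/-- The substitution `s ↦ s ∘̃ (δ + d) = ∑_η (s, η) φ_d(η)(1)` on scalar series; on the
components of a vector valued series it is the mixed composition product. -/
noncomputable def subst (d : Series 𝕜 m m) (s : ScalarSeries 𝕜 m) : ScalarSeries 𝕜 m := fun ν =>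
  ∑ᶠ η : Word m, s η * phi d η oneSeries ν

theorem mixedComp_apply (c : Series 𝕜 m l) (d : Series 𝕜 m m) (ν : Word m) (i : Fin l) :
    mixedComp c d ν i = subst d (fun η => c η i) ν := rfl

theorem subst_eq_sum (d : Series 𝕜 m m) (s : ScalarSeries 𝕜 m) {ν : Word m} {n : ℕ}
    (hn : ν.length ≤ n) :
    subst d s ν = ∑ η ∈ wordsLE m n, s η * phi d η oneSeries ν := by
  refine finsum_eq_sum_of_support_subset _ fun η hη => ?_
  by_contra h
  refine hη ?_
  simp only [Finset.mem_coe, mem_wordsLE, not_le] at h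
  simp only [phi_one_eq_zero d η ν (hn.trans_lt h), mul_zero]

/-- The substitution `s ↦ s ∘̃ (δ + d)` as a linear map. -/
noncomputable def substLinear (d : Series 𝕜 m m) : ScalarSeries 𝕜 m →ₗ[𝕜] ScalarSeries 𝕜 m where
  toFun := subst d
  map_add' s t := by
    ext ν
    simp [subst_eq_sum d _ le_rfl, add_mul, Finset.sum_add_distrib]
  map_smul' a s := by
    ext ν
    simp [subst_eq_sum d _ le_rfl, Finset.mul_sum, mul_assoc]

theorem subst_add (d : Series 𝕜 m m) (s t : ScalarSeries 𝕜 m) :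
    subst d (s + t) = subst d s + subst d t := map_add (substLinear d) s t

theorem subst_zero (d : Series 𝕜 m m) : subst d 0 = 0 := map_zero (substLinear d)

theorem subst_congr (d : Series 𝕜 m m) {s t : ScalarSeries 𝕜 m} {ν : Word m}
    (h : ∀ η : Word m, η.length ≤ ν.length → s η = t η) : subst d s ν = subst d t ν := by
  rw [subst_eq_sum d s le_rfl, subst_eq_sum d t le_rfl]
  exact Finset.sum_congr rfl fun η hη => by rw [h η (mem_wordsLE.1 hη)]

theorem subst_nil (d : Series 𝕜 m m) (s : ScalarSeries 𝕜 m) : subst d s [] = s [] := by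
  rw [subst_eq_sum d s (n := 0) le_rfl]
  simp [wordsLE, phi, oneSeries]

@[simp]
theorem component_zero (d : Series 𝕜 m m) : component d 0 = 0 := rfl

@[simp]
theorem phiLetter_nil (d : Series 𝕜 m m) (i : Fin (m + 1)) (e : ScalarSeries 𝕜 m) :
    phiLetter d i e [] = 0 := by
  simp [phiLetter, letterMul]

theorem phiLetter_cons (d : Series 𝕜 m m) (i : Fin (m + 1)) (e : ScalarSeries 𝕜 m)
    (k : Fin (m + 1)) (ν : Word m) :
    phiLetter d i e (k :: ν) =
      (if k = i then e ν else 0) + if k = 0 then shuffle (component d i) e ν else 0 := rfl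

/-- The left quotients of `s ∘̃ (δ + d)`. With `subst_nil` this determines the substitution. -/
theorem subst_cons (d : Series 𝕜 m m) (s : ScalarSeries 𝕜 m) (k : Fin (m + 1)) (ν : Word m) :
    subst d s (k :: ν) = subst d (leftQuot k s) ν +
      if k = 0 then ∑ i, shuffle (component d i) (subst d (leftQuot i s)) ν else 0 := by
  have key : ∀ i, shuffle (component d i) (subst d (leftQuot i s)) ν =
      ∑ η ∈ wordsLE m ν.length,
        s (i :: η) * shuffle (component d i) (phi d η oneSeries) ν := by
    intro i
    -- In degrees `≤ |ν|` the substitution is a finite sum, which commutes with the shuffle product.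
    rw [shuffle_congr (n := ν.length) (c' := component d i)
      (d' := ∑ η ∈ wordsLE m ν.length, s (i :: η) • phi d η oneSeries)
      (fun _ _ => rfl) _ le_rfl]
    · simp [shuffle_sum, shuffle_smul]
    · intro μ hμ
      rw [subst_eq_sum d _ hμ]
      simp
  rw [subst_eq_sum d s (n := ν.length + 1) (by simp), sum_wordsLE_succ,
    subst_eq_sum d _ (le_refl ν.length)]
  simp only [key, phi, oneSeries, mul_zero, zero_add, phiLetter_cons, mul_add,
    Finset.sum_add_distrib]
  congr 1
  · rw [Finset.sum_eq_single_of_mem k (Finset.mem_univ _)]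
    · simp
    · intro i _ hi
      simp [hi.symm]
  · split_ifs <;> simp

theorem leftQuot_subst (d : Series 𝕜 m m) (s : ScalarSeries 𝕜 m) (k : Fin (m + 1)) :
    leftQuot k (subst d s) = subst d (leftQuot k s) +
      if k = 0 then ∑ i, shuffle (component d i) (subst d (leftQuot i s)) else 0 := by
  ext ν
  rw [leftQuot_apply, subst_cons]
  split_ifs <;> simp

/-- Substitution is an endomorphism of the shuffle algebra. -/
theorem subst_shuffle (d : Series 𝕜 m m) (s t : ScalarSeries 𝕜 m) :
    subst d (shuffle s t) = shuffle (subst d s) (subst d t) := by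
  suffices H : ∀ (n : ℕ) (ν : Word m), ν.length ≤ n → ∀ s t : ScalarSeries 𝕜 m,
      subst d (shuffle s t) ν = shuffle (subst d s) (subst d t) ν from
    funext fun ν => H _ ν le_rfl s t
  intro n
  induction n with
  | zero =>
    intro ν hν s t
    rw [List.eq_nil_of_length_eq_zero (Nat.le_zero.1 hν)]
    simp only [subst_nil, shuffle_nil]
  | succ n ih =>
    intro ν hν s t
    cases ν with
    | nil => simp only [subst_nil, shuffle_nil]
    | cons k ν =>
      have hν' : ν.length ≤ n := by simpa using hν
      have key : ∀ i, shuffle (component d i) (subst d (leftQuot i (shuffle s t))) ν =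
          shuffle (component d i) (shuffle (subst d (leftQuot i s)) (subst d t)) ν +
          shuffle (component d i) (shuffle (subst d s) (subst d (leftQuot i t))) ν := by
        intro i
        rw [← Pi.add_apply, ← shuffle_add]
        refine shuffle_congr (fun _ _ => rfl) (fun η hη => ?_) hν'
        rw [leftQuot_shuffle, subst_add, Pi.add_apply, Pi.add_apply, ih η hη, ih η hη]
      -- Both sides are now sums of shuffles of three series, equal up to the order of the factors.
      rw [subst_cons, shuffle_cons]
      simp only [leftQuot_subst, key, Finset.sum_add_distrib]
      rw [leftQuot_shuffle, subst_add, Pi.add_apply, ih ν hν', ih ν hν']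
      split_ifs
      · simp only [add_shuffle, shuffle_add, Pi.add_apply, shuffle_sum, Finset.sum_apply,
          shuffle_comm (∑ i, _) (subst d t)]
        simp only [shuffle_left_comm (subst d s), shuffle_comm (subst d t), shuffle_assoc]
        ring
      · simp

theorem subst_letterMul (d : Series 𝕜 m m) (i : Fin (m + 1)) (s : ScalarSeries 𝕜 m) :
    subst d (letterMul i s) = phiLetter d i (subst d s) := by
  have hq : ∀ k, leftQuot k (letterMul i s) = if k = i then s else 0 := by
    intro k
    ext ν
    simp only [leftQuot_apply, letterMul]
    split_ifs <;> rfl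
  ext ν
  cases ν with
  | nil => rw [subst_nil, phiLetter_nil, letterMul]
  | cons k ν =>
    rw [subst_cons, phiLetter_cons, hq]
    congr 1
    · split_ifs
      · rfl
      · rw [subst_zero, Pi.zero_apply]
    · congr 1
      rw [Finset.sum_eq_single_of_mem i (Finset.mem_univ _)]
      · rw [hq, if_pos rfl]
      · intro j _ hj
        rw [hq, if_neg hj, subst_zero, shuffle_zero, Pi.zero_apply]

theorem subst_oneSeries (d : Series 𝕜 m m) : subst d oneSeries = oneSeries := by
  have hq : ∀ k : Fin (m + 1), leftQuot k (oneSeries : ScalarSeries 𝕜 m) = 0 := fun k => rfl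
  ext ν
  cases ν with
  | nil => exact subst_nil d _
  | cons k ν => simp [subst_cons, hq, subst_zero, shuffle_zero, oneSeries]

theorem component_add_mixedComp (d e : Series 𝕜 m m) (i : Fin (m + 1)) :
    component (e + mixedComp d e) i = component e i + subst e (component d i) := by
  cases i using Fin.cases with
  | zero => simp [subst_zero]
  | succ j => rfl

/-- Substitution of `δ + e` intertwines `φ_d` with `φ_{d'}`, where
`δ + d' = (δ + d) ∘ (δ + e)`. -/
theorem subst_phiLetter (d e : Series 𝕜 m m) (i : Fin (m + 1)) (s : ScalarSeries 𝕜 m) :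
    subst e (phiLetter d i s) = phiLetter (e + mixedComp d e) i (subst e s) := by
  -- The letter `x_0` is left alone, as `e[0] = 0`.
  have h0 : ∀ t : ScalarSeries 𝕜 m, subst e (letterMul 0 t) = letterMul 0 (subst e t) := by
    intro t
    rw [subst_letterMul]
    ext ν
    cases ν with
    | nil => rw [phiLetter_nil, letterMul]
    | cons k ν => simp [phiLetter_cons, zero_shuffle, letterMul]
  rw [phiLetter, subst_add, subst_letterMul, h0, subst_shuffle]
  ext ν
  cases ν with
  | nil => simp [letterMul]
  | cons k ν =>
    rw [Pi.add_apply, phiLetter_cons, phiLetter_cons, component_add_mixedComp, add_shuffle,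
      letterMul, Pi.add_apply]
    split_ifs <;> ring

theorem subst_phi_one (d e : Series 𝕜 m m) (η : Word m) :
    subst e (phi d η oneSeries) = phi (e + mixedComp d e) η oneSeries := by
  induction η with
  | nil => exact subst_oneSeries e
  | cons i η ih => rw [phi, phi, subst_phiLetter, ih]

/-- Substituting `δ + d` and then `δ + e` is substituting `(δ + d) ∘ (δ + e)`. -/
theorem subst_subst (d e : Series 𝕜 m m) (s : ScalarSeries 𝕜 m) :
    subst e (subst d s) = subst (e + mixedComp d e) s := by
  ext ν
  rw [subst_congr (t := ∑ η ∈ wordsLE m ν.length, s η • phi d η oneSeries),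
    subst_eq_sum _ s le_rfl]
  · change substLinear e _ ν = _
    rw [map_sum, Finset.sum_apply]
    refine Finset.sum_congr rfl fun η _ => ?_
    rw [map_smul, Pi.smul_apply, smul_eq_mul, ← subst_phi_one]
    rfl
  · intro μ hμ
    rw [subst_eq_sum d s hμ]
    simp

theorem subst_zero_left (s : ScalarSeries 𝕜 m) : subst 0 s = s := by
  have hc : ∀ i : Fin (m + 1), component (0 : Series 𝕜 m m) i = 0 := by
    intro i
    cases i using Fin.cases <;> rfl
  ext ν
  induction ν generalizing s with
  | nil => exact subst_nil 0 s
  | cons k ν ih => simp [subst_cons, ih, hc, zero_shuffle]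

/-- The coefficients of `s ∘̃ (δ + d)` of degree `n` involve `d` in degrees less than `n` only. -/
theorem subst_congr_left {d d' : Series 𝕜 m m} {ν : Word m}
    (h : ∀ η : Word m, η.length < ν.length → d η = d' η) (s : ScalarSeries 𝕜 m) :
    subst d s ν = subst d' s ν := by
  suffices H : ∀ (n : ℕ), (∀ η : Word m, η.length < n → d η = d' η) → ∀ ν : Word m,
      ν.length ≤ n → ∀ s, subst d s ν = subst d' s ν from H _ h ν le_rfl s
  clear h
  intro n h
  induction n with
  | zero =>
    intro ν hν s
    rw [List.eq_nil_of_length_eq_zero (Nat.le_zero.1 hν), subst_nil, subst_nil]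
  | succ n ih =>
    intro ν hν s
    replace ih := ih fun η hη => h η (by omega)
    cases ν with
    | nil => rw [subst_nil, subst_nil]
    | cons k ν =>
      have hν' : ν.length ≤ n := by simpa using hν
      rw [subst_cons, subst_cons, ih ν hν']
      congr 2
      refine Finset.sum_congr rfl fun i _ => shuffle_congr (fun η hη => ?_)
        (fun η hη => ih η hη _) hν'
      cases i using Fin.cases with
      | zero => rfl
      | succ j => exact congrFun (h η (by omega)) j

/-- The iterates, starting from `0`, of `d ↦ -(c ∘̃ (δ + d))`, whose fixed point `d` gives the
inverse `δ + d` of `δ + c`. -/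
noncomputable def invApprox (c : Series 𝕜 m m) : ℕ → Series 𝕜 m m
  | 0 => 0
  | n + 1 => -mixedComp c (invApprox c n)

theorem invApprox_succ_apply (c : Series 𝕜 m m) (n : ℕ) (ν : Word m) (hν : ν.length < n) :
    invApprox c (n + 1) ν = invApprox c n ν := by
  induction n generalizing ν with
  | zero => omega
  | succ n ih =>
    ext i
    change -subst (invApprox c (n + 1)) _ ν = -subst (invApprox c n) _ ν
    rw [subst_congr_left fun η hη => ih η (by omega)]

/-- The series `d` with `(δ + c) ∘ (δ + d) = δ`; the iterates are stationary in each
coefficient. -/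
noncomputable def invSeries (c : Series 𝕜 m m) : Series 𝕜 m m := fun ν =>
  invApprox c (ν.length + 1) ν

theorem invApprox_apply (c : Series 𝕜 m m) {n : ℕ} {ν : Word m} (hν : ν.length < n) :
    invApprox c n ν = invSeries c ν := by
  induction n, hν using Nat.le_induction with
  | base => rfl
  | succ n hn ih => rw [invApprox_succ_apply c n ν hn, ih]

theorem invSeries_add_mixedComp (c : Series 𝕜 m m) :
    invSeries c + mixedComp c (invSeries c) = 0 := by
  ext ν i
  rw [Pi.add_apply, Pi.add_apply, invSeries, invApprox, Pi.neg_apply, Pi.neg_apply,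
    mixedComp_apply, mixedComp_apply, subst_congr_left fun η hη => invApprox_apply c hη]
  simp

namespace UnitalSeries

theorem comp_assoc (c d e : UnitalSeries 𝕜 m) : comp (comp c d) e = comp c (comp d e) := by
  ext ν i
  change _ + subst e.toSeries ((fun η => d.toSeries η i) +
    subst d.toSeries fun η => c.toSeries η i) ν = _ + _ + subst _ (fun η => c.toSeries η i) ν
  rw [subst_add, subst_subst, Pi.add_apply, ← add_assoc]
  rfl

theorem comp_delta (c : UnitalSeries 𝕜 m) : comp c delta = c := by
  ext ν i
  simp [comp, delta, mixedComp_apply, subst_zero_left]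

theorem comp_invSeries (c : UnitalSeries 𝕜 m) : comp c ⟨invSeries c.toSeries⟩ = delta :=
  UnitalSeries.ext (invSeries_add_mixedComp c.toSeries)

/-- The group `δ + 𝕜^m⟨⟨X⟩⟩`. -/
@[reducible]
noncomputable def groupStr (𝕜 : Type*) [Field 𝕜] (m : ℕ) : Group (UnitalSeries 𝕜 m) :=
  letI : Mul (UnitalSeries 𝕜 m) := ⟨comp⟩
  letI : One (UnitalSeries 𝕜 m) := ⟨delta⟩
  letI : Inv (UnitalSeries 𝕜 m) := ⟨fun c => ⟨invSeries c.toSeries⟩⟩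
  Group.ofRightAxioms comp_assoc comp_delta comp_invSeries

end UnitalSeries

end Substitution

/-! ### Polynomial coordinates of the group operations -/

section PolynomialCoefficients

variable {𝕜 : Type*} [Field 𝕜] {m l : ℕ} {σ : Type*}

/-- `f` is a polynomial function of the variables `x s`, `s : σ`; only finitely many of them can
occur. -/
def IsPolynomial (f : (σ → 𝕜) → 𝕜) : Prop :=
  ∃ P : MvPolynomial σ 𝕜, ∀ x, f x = MvPolynomial.eval x P

namespace IsPolynomial

theorem const (a : 𝕜) : IsPolynomial fun _ : σ → 𝕜 => a := ⟨MvPolynomial.C a, by simp⟩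

theorem coord (s : σ) : IsPolynomial fun x : σ → 𝕜 => x s := ⟨MvPolynomial.X s, by simp⟩

variable {f g : (σ → 𝕜) → 𝕜}

theorem add (hf : IsPolynomial f) (hg : IsPolynomial g) : IsPolynomial fun x => f x + g x := by
  obtain ⟨P, hP⟩ := hf
  obtain ⟨Q, hQ⟩ := hg
  exact ⟨P + Q, by simp [hP, hQ]⟩

theorem mul (hf : IsPolynomial f) (hg : IsPolynomial g) : IsPolynomial fun x => f x * g x := by
  obtain ⟨P, hP⟩ := hf
  obtain ⟨Q, hQ⟩ := hg
  exact ⟨P * Q, by simp [hP, hQ]⟩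

theorem neg (hf : IsPolynomial f) : IsPolynomial fun x => -f x := by
  obtain ⟨P, hP⟩ := hf
  exact ⟨-P, by simp [hP]⟩

theorem sum {ι : Type*} (s : Finset ι) {f : ι → (σ → 𝕜) → 𝕜} (hf : ∀ i, IsPolynomial (f i)) :
    IsPolynomial fun x => ∑ i ∈ s, f i x := by
  choose P hP using hf
  exact ⟨∑ i ∈ s, P i, by simp [hP]⟩

theorem shuffle {c d : (σ → 𝕜) → ScalarSeries 𝕜 m} (hc : ∀ ν, IsPolynomial fun x => c x ν)
    (hd : ∀ ν, IsPolynomial fun x => d x ν) (ν : Word m) :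
    IsPolynomial fun x => ChenFliess.shuffle (c x) (d x) ν := by
  simp only [shuffle_eq_sum _ _ ν le_rfl le_rfl]
  exact sum _ fun η => sum _ fun ξ => ((hc η).mul (hd ξ)).mul (const _)

theorem phi {d : (σ → 𝕜) → Series 𝕜 m m} (hd : ∀ ν i, IsPolynomial fun x => d x ν i)
    (η ν : Word m) : IsPolynomial fun x => ChenFliess.phi (d x) η oneSeries ν := by
  induction η generalizing ν with
  | nil => exact const _
  | cons i η ih =>
    cases ν with
    | nil => simpa [ChenFliess.phi] using const 0
    | cons k ν =>
      simp only [ChenFliess.phi, phiLetter_cons]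
      refine add ?_ ?_
      · split_ifs
        · exact ih ν
        · exact const 0
      · split_ifs
        · refine shuffle (fun μ => ?_) ih ν
          cases i using Fin.cases with
          | zero => exact const 0
          | succ j => exact hd μ j
        · exact const 0

theorem mixedComp {c : (σ → 𝕜) → Series 𝕜 m l} {d : (σ → 𝕜) → Series 𝕜 m m}
    (hc : ∀ ν i, IsPolynomial fun x => c x ν i) (hd : ∀ ν i, IsPolynomial fun x => d x ν i)
    (ν : Word m) (i : Fin l) : IsPolynomial fun x => ChenFliess.mixedComp (c x) (d x) ν i := by
  simp only [mixedComp_apply, subst_eq_sum _ _ (le_refl ν.length)]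
  exact sum _ fun η => (hc η i).mul (phi hd η ν)

theorem invSeries {c : (σ → 𝕜) → Series 𝕜 m m} (hc : ∀ ν i, IsPolynomial fun x => c x ν i)
    (ν : Word m) (i : Fin m) : IsPolynomial fun x => ChenFliess.invSeries (c x) ν i := by
  suffices H : ∀ n ν i, IsPolynomial fun x => invApprox (c x) n ν i from H _ _ _
  intro n
  induction n with
  | zero => exact fun ν i => const 0
  | succ n ih => exact fun ν i => (mixedComp hc ih ν i).neg

end IsPolynomial

theorem UnitalSeries.hasPolynomialOperations (𝕜 : Type*) [Field 𝕜] (m : ℕ) :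
    @HasPolynomialOperations 𝕜 _ m (groupStr 𝕜 m) := by
  intro η i
  constructor
  · obtain ⟨P, hP⟩ : IsPolynomial fun x : (Word m × Fin m) ⊕ (Word m × Fin m) → 𝕜 =>
        x (.inr (η, i)) +
          mixedComp (fun ν j => x (.inl (ν, j)) : Series 𝕜 m m) (fun ν j => x (.inr (ν, j))) η i :=
      (IsPolynomial.coord _).add
        (.mixedComp (fun ν j => .coord _) (fun ν j => .coord _) η i)
    exact ⟨P, fun c d => hP (Sum.elim (fun q => c.toSeries q.1 q.2) fun q => d.toSeries q.1 q.2)⟩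
  · obtain ⟨Q, hQ⟩ : IsPolynomial fun x : Word m × Fin m → 𝕜 =>
        invSeries (fun ν j => x (ν, j)) η i := .invSeries (fun ν j => .coord _) η i
    exact ⟨Q, fun c => hQ fun q => c.toSeries q.1 q.2⟩

end PolynomialCoefficients

/-! ### Smoothness of polynomial functions -/

section SmoothPolynomials

variable {𝕜 : Type*} [NontriviallyNormedField 𝕜]
  {E : Type*} [AddCommGroup E] [Module 𝕜 E]
  {F : Type*} [AddCommGroup F] [Module 𝕜 F] [TopologicalSpace F]
  {F' : Type*} [AddCommGroup F'] [Module 𝕜 F'] [TopologicalSpace F']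

theorem hasDirDeriv_iff_hasDerivAt {f : E → 𝕜} {f' : 𝕜} {x y : E} :
    HasDirDeriv 𝕜 f f' x y ↔ HasDerivAt (fun t : 𝕜 => f (x + t • y)) f' 0 := by
  simp [hasDerivAt_iff_tendsto_slope_zero, HasDirDeriv]

theorem HasDirDeriv.clm_comp {f : E → F} {f' : F} {x y : E} (hf : HasDirDeriv 𝕜 f f' x y)
    (T : F →L[𝕜] F') : HasDirDeriv 𝕜 (fun z => T (f z)) (T f') x y := by
  have h := (T.continuous.tendsto f').comp hf
  simpa [HasDirDeriv, Function.comp_def] using h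

variable [TopologicalSpace E]
  {E' : Type*} [AddCommGroup E'] [Module 𝕜 E'] [TopologicalSpace E']

/-- The algebra of functions generated by the continuous linear functionals on `E`. -/
inductive IsPolynomialFun (𝕜 : Type*) [NontriviallyNormedField 𝕜] {E : Type*} [AddCommGroup E]
    [Module 𝕜 E] [TopologicalSpace E] : (E → 𝕜) → Prop
  | const (a : 𝕜) : IsPolynomialFun 𝕜 fun _ => a
  | clm (ℓ : E →L[𝕜] 𝕜) : IsPolynomialFun 𝕜 fun x => ℓ x
  | add {f g : E → 𝕜} : IsPolynomialFun 𝕜 f → IsPolynomialFun 𝕜 g →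
      IsPolynomialFun 𝕜 fun x => f x + g x
  | mul {f g : E → 𝕜} : IsPolynomialFun 𝕜 f → IsPolynomialFun 𝕜 g →
      IsPolynomialFun 𝕜 fun x => f x * g x

namespace IsPolynomialFun

theorem eval {σ : Type*} (ℓ : σ → E →L[𝕜] 𝕜) (P : MvPolynomial σ 𝕜) :
    IsPolynomialFun 𝕜 fun x => MvPolynomial.eval (fun s => ℓ s x) P := by
  induction P using MvPolynomial.induction_on with
  | C a => simpa using const a
  | add P Q hP hQ => simpa using hP.add hQ
  | mul_X P s hP => simpa using hP.mul (clm (ℓ s))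

theorem comp_clm {f : E' → 𝕜} (hf : IsPolynomialFun 𝕜 f) (T : E →L[𝕜] E') :
    IsPolynomialFun 𝕜 fun x => f (T x) := by
  induction hf with
  | const a => exact const a
  | clm ℓ => exact clm (ℓ.comp T)
  | add _ _ hf hg => exact hf.add hg
  | mul _ _ hf hg => exact hf.mul hg

theorem continuous {f : E → 𝕜} (hf : IsPolynomialFun 𝕜 f) : Continuous f := by
  induction hf with
  | const a => exact continuous_const
  | clm ℓ => exact ℓ.continuous
  | add _ _ hf hg => exact hf.add hg
  | mul _ _ hf hg => exact hf.mul hg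

/-- Directional derivatives of a polynomial function of `(x, y₁, …, y_k)` with respect to `x` are
polynomial functions of `x`, `y₁, …, y_k` and the direction. -/
theorem exists_hasDirDeriv {k : ℕ} {f : E × (Fin k → E) → 𝕜} (hf : IsPolynomialFun 𝕜 f) :
    ∃ f' : E × (Fin (k + 1) → E) → 𝕜, IsPolynomialFun 𝕜 f' ∧
      ∀ (x : E) (y : Fin k → E) (w : E),
        HasDirDeriv 𝕜 (fun z => f (z, y)) (f' (x, Fin.snoc (α := fun _ => E) y w)) x w := by
  -- The map that forgets the last direction.
  let T : E × (Fin (k + 1) → E) →L[𝕜] E × (Fin k → E) :=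
    (ContinuousLinearMap.fst 𝕜 _ _).prod (ContinuousLinearMap.pi fun i : Fin k =>
      (ContinuousLinearMap.proj i.castSucc).comp (ContinuousLinearMap.snd 𝕜 _ _))
  have hT : ∀ x (y : Fin k → E) w, T (x, Fin.snoc (α := fun _ => E) y w) = (x, y) := by
    intro x y w
    refine Prod.ext rfl (funext fun i => ?_)
    exact Fin.snoc_castSucc (α := fun _ => E) _ _ _
  simp only [hasDirDeriv_iff_hasDerivAt]
  induction hf with
  | const a => exact ⟨_, const 0, fun x y w => hasDerivAt_const 0 a⟩
  | clm ℓ =>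
    refine ⟨_, clm (ℓ.comp (((ContinuousLinearMap.proj (Fin.last k)).comp
      (ContinuousLinearMap.snd 𝕜 _ _)).prod 0)), fun x y w => ?_⟩
    have h : ∀ t : 𝕜, ℓ (x + t • w, y) = ℓ (x, y) + t * ℓ (w, 0) := by
      intro t
      rw [← smul_eq_mul, ← map_smul, ← map_add]
      simp
    simpa [h] using ((hasDerivAt_id (0 : 𝕜)).mul_const (ℓ (w, 0))).const_add (ℓ (x, y))
  | add _ _ hf hg =>
    obtain ⟨f', hf', hf⟩ := hf
    obtain ⟨g', hg', hg⟩ := hg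
    exact ⟨_, hf'.add hg', fun x y w => (hf x y w).add (hg x y w)⟩
  | @mul f g pf pg hf hg =>
    obtain ⟨f', hf', hf⟩ := hf
    obtain ⟨g', hg', hg⟩ := hg
    refine ⟨_, (hf'.mul (pg.comp_clm T)).add ((pf.comp_clm T).mul hg'), fun x y w => ?_⟩
    have h := (hf x y w).mul (hg x y w)
    simp only [zero_smul, add_zero] at h
    simp only [hT]
    exact h

/-- Polynomial functions are smooth, since the class is closed under directional derivatives. -/
theorem isCrOn {f : E → 𝕜} (hf : IsPolynomialFun 𝕜 f) : IsCrOn 𝕜 ⊤ f univ := by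
  -- The iterated derivatives, chosen recursively together with their polynomiality.
  let D : (k : ℕ) → {g : E × (Fin k → E) → 𝕜 // IsPolynomialFun 𝕜 g} := fun k =>
    Nat.rec ⟨fun p => f p.1, hf.comp_clm (ContinuousLinearMap.fst 𝕜 E (Fin 0 → E))⟩
      (fun _ g => ⟨g.2.exists_hasDirDeriv.choose, g.2.exists_hasDirDeriv.choose_spec.1⟩) k
  refine ⟨isOpen_univ, fun k x y => (D k).1 (x, y), fun x _ y => rfl, fun k _ x _ y w => ?_,
    fun k _ => (D k).2.continuous.continuousOn⟩
  exact (D k).2.exists_hasDirDeriv.choose_spec.2 x y w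

end IsPolynomialFun

theorem IsCrOn.clm_comp {r : ℕ∞} {f : E → F} {U : Set E} (hf : IsCrOn 𝕜 r f U)
    (T : F →L[𝕜] F') : IsCrOn 𝕜 r (fun x => T (f x)) U := by
  obtain ⟨hU, D, h0, hD, hc⟩ := hf
  exact ⟨hU, fun k x y => T (D k x y), fun x hx y => congrArg T (h0 x hx y),
    fun k hk x hx y w => (hD k hk x hx y w).clm_comp T,
    fun k hk => T.continuous.comp_continuousOn (hc k hk)⟩

theorem IsCrOn.pi {ι : Type*} {r : ℕ∞} {f : E → ι → F} {U : Set E} (hU : IsOpen U)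
    (hf : ∀ i, IsCrOn 𝕜 r (fun x => f x i) U) : IsCrOn 𝕜 r f U := by
  choose hU' D h0 hD hc using hf
  exact ⟨hU, fun k x y i => D i k x y, fun x hx y => funext fun i => h0 i x hx y,
    fun k hk x hx y w => tendsto_pi_nhds.2 fun i => hD i k hk x hx y w,
    fun k hk => continuousOn_pi.2 fun i => hc i k hk⟩

theorem continuous_of_eval {m l : ℕ} {σ : Type*} (ℓ : σ → E →L[𝕜] 𝕜)
    (P : Word m → Fin l → MvPolynomial σ 𝕜) {f : E → Series 𝕜 m l}
    (hf : ∀ x ν i, f x ν i = MvPolynomial.eval (fun s => ℓ s x) (P ν i)) : Continuous f := by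
  refine continuous_pi fun ν => continuous_pi fun i => ?_
  simp only [hf]
  exact (IsPolynomialFun.eval ℓ (P ν i)).continuous

end SmoothPolynomials

/-! ### Analyticity of maps with polynomial coordinates -/

section AnalyticPolynomials

/-- Maps with polynomial coordinates are complex analytic. -/
theorem isComplexAnalyticOn_of_eval {E : Type} [AddCommGroup E] [Module ℂ E]
    [TopologicalSpace E] {m l : ℕ} {σ : Type*} (ℓ : σ → E →L[ℂ] ℂ)
    (P : Word m → Fin l → MvPolynomial σ ℂ) {f : E → Series ℂ m l}
    (hf : ∀ x ν i, f x ν i = MvPolynomial.eval (fun s => ℓ s x) (P ν i)) :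
    IsComplexAnalyticOn E (Series ℂ m l) f univ := by
  refine IsCrOn.pi isOpen_univ fun ν => IsCrOn.pi isOpen_univ fun i => ?_
  simp only [hf]
  exact (IsPolynomialFun.eval ℓ (P ν i)).isCrOn

/-- The complex linear extension `u + i v ↦ ℓ u + i ℓ v` of a real linear functional. -/
noncomputable def Complexification.extend {E : Type*} [AddCommGroup E] [Module ℝ E]
    [TopologicalSpace E] (ℓ : E →L[ℝ] ℝ) : Complexification E →L[ℂ] ℂ where
  toFun p := ⟨ℓ p.1, ℓ p.2⟩
  map_add' p q := Complex.ext (map_add ℓ p.1 q.1) (map_add ℓ p.2 q.2)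
  map_smul' z p := by
    apply Complex.ext <;> simp [Complexification.smul_eq]
  cont := by
    have h : Continuous fun p : E × E => ((ℓ p.1 : ℝ) : ℂ) + (ℓ p.2 : ℝ) * Complex.I := by
      fun_prop
    exact h.congr fun p => (Complex.mk_eq_add_mul_I _ _).symm

theorem Complexification.extend_incl {E : Type*} [AddCommGroup E] [Module ℝ E]
    [TopologicalSpace E] (ℓ : E →L[ℝ] ℝ) (x : E) :
    extend ℓ (incl x) = (ℓ x : ℂ) :=
  Complex.ext rfl (map_zero ℓ)

/-- Splitting a complex series into its real and imaginary parts. -/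
noncomputable def reImSeries (m l : ℕ) :
    Series ℂ m l →L[ℂ] Complexification (Series ℝ m l) where
  toFun c := (fun ν i => (c ν i).re, fun ν i => (c ν i).im)
  map_add' c d := rfl
  map_smul' z c := by
    refine Prod.ext (funext fun ν => funext fun i => ?_) (funext fun ν => funext fun i => ?_)
    · exact Complex.mul_re _ _
    · exact Complex.mul_im _ _
  cont := by
    have h : Continuous fun c : Series ℂ m l =>
        ((fun ν i => (c ν i).re, fun ν i => (c ν i).im) : Series ℝ m l × Series ℝ m l) := by
      fun_prop
    exact h

/-- Maps with polynomial coordinates are real analytic: the same polynomials extend them to the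
complexification. -/
theorem isRealAnalyticOn_of_eval {E : Type} [AddCommGroup E] [Module ℝ E]
    [TopologicalSpace E] {m l : ℕ} {σ : Type*} (ℓ : σ → E →L[ℝ] ℝ)
    (P : Word m → Fin l → MvPolynomial σ ℝ) {f : E → Series ℝ m l}
    (hf : ∀ x ν i, f x ν i = MvPolynomial.eval (fun s => ℓ s x) (P ν i)) :
    IsRealAnalyticOn E (Series ℝ m l) f univ := by
  let g : Complexification E → Series ℂ m l := fun p ν i =>
    MvPolynomial.eval (fun s => Complexification.extend (ℓ s) p)
      ((P ν i).map (algebraMap ℝ ℂ))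
  have hg : IsComplexAnalyticOn (Complexification E) (Series ℂ m l) g univ :=
    isComplexAnalyticOn_of_eval _ _ fun _ _ _ => rfl
  have key : ∀ x ν i, g (Complexification.incl x) ν i = (f x ν i : ℂ) := by
    intro x ν i
    simp only [g, Complexification.extend_incl, hf, MvPolynomial.eval_map]
    exact (MvPolynomial.eval₂_comp (algebraMap ℝ ℂ) _ _).symm
  refine ⟨isOpen_univ, univ, fun p => reImSeries m l (g p), hg.clm_comp _, fun x _ =>
    ⟨mem_univ _, ?_⟩⟩
  refine Prod.ext (funext fun ν => funext fun i => ?_) (funext fun ν => funext fun i => ?_)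
  · exact (congrArg Complex.re (key x ν i)).trans (Complex.ofReal_re _)
  · exact (congrArg Complex.im (key x ν i)).trans (Complex.ofReal_im _)

end AnalyticPolynomials

/-! ### The Lie group structure -/

section LieGroup

namespace UnitalSeries

variable {𝕜 : Type} [NontriviallyNormedField 𝕜] {m : ℕ}

theorem eq_of_mem_atlas {e : OpenPartialHomeomorph (UnitalSeries 𝕜 m) (Series 𝕜 m m)}
    (he : e ∈ atlas (Series 𝕜 m m) (UnitalSeries 𝕜 m)) :
    e = (homeoSeries 𝕜 m).toOpenPartialHomeomorph := he

/-- The coordinate functional `c ↦ (c, η)_i`, indexed by the pair `(η, i)`. -/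
noncomputable def coordinate (𝕜 : Type*) [NontriviallyNormedField 𝕜] (m l : ℕ)
    (q : Word m × Fin l) :
    Series 𝕜 m l →L[𝕜] 𝕜 :=
  (ContinuousLinearMap.proj (R := 𝕜) (φ := fun _ : Fin l => 𝕜) q.2).comp
    (ContinuousLinearMap.proj (φ := fun _ : Word m => Fin l → 𝕜) q.1)

/-- As the group operations have polynomial coordinates, `δ + 𝕜^m⟨⟨X⟩⟩` is a Lie group for every
class of maps which contains the maps with polynomial coordinates. -/
theorem isLieGroupOf (A : MapClass.{0} 𝕜)
    (hA : ∀ (E : Type) [AddCommGroup E] [Module 𝕜 E] [TopologicalSpace E] (σ : Type)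
      (ℓ : σ → E →L[𝕜] 𝕜) (P : Word m → Fin m → MvPolynomial σ 𝕜) (f : E → Series 𝕜 m m),
      (∀ x ν i, f x ν i = MvPolynomial.eval (fun s => ℓ s x) (P ν i)) →
        A E (Series 𝕜 m m) f univ) :
    @IsLieGroupOf 𝕜 _ A (Series 𝕜 m m) _ _ _ (UnitalSeries 𝕜 m) (groupStr 𝕜 m) _ _ := by
  let _ := groupStr 𝕜 m
  have hpoly := hasPolynomialOperations 𝕜 m
  choose P hP using fun η i => (hpoly η i).1
  choose Q hQ using fun η i => (hpoly η i).2
  let mulChart : Series 𝕜 m m × Series 𝕜 m m → Series 𝕜 m m :=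
    fun p => ((⟨p.1⟩ : UnitalSeries 𝕜 m) * ⟨p.2⟩).toSeries
  let invChart : Series 𝕜 m m → Series 𝕜 m m := fun c => (⟨c⟩ : UnitalSeries 𝕜 m)⁻¹.toSeries
  let ℓ : (Word m × Fin m) ⊕ (Word m × Fin m) → Series 𝕜 m m × Series 𝕜 m m →L[𝕜] 𝕜 :=
    Sum.elim (fun q => (coordinate 𝕜 m m q).comp (ContinuousLinearMap.fst 𝕜 _ _))
      (fun q => (coordinate 𝕜 m m q).comp (ContinuousLinearMap.snd 𝕜 _ _))
  have hmul : ∀ p η i, mulChart p η i = MvPolynomial.eval (fun s => ℓ s p) (P η i) := by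
    intro p η i
    refine (hP η i ⟨p.1⟩ ⟨p.2⟩).trans (congrArg (MvPolynomial.eval · (P η i)) (funext fun s => ?_))
    cases s <;> rfl
  have hinv : ∀ c η i, invChart c η i =
      MvPolynomial.eval (fun q => coordinate 𝕜 m m q c) (Q η i) := fun c η i => hQ η i ⟨c⟩
  have hid : ∀ (c : Series 𝕜 m m) η i, id c η i =
      MvPolynomial.eval (fun q => coordinate 𝕜 m m q c) (MvPolynomial.X (η, i)) := by
    intro c η i
    rw [MvPolynomial.eval_X]
    rfl
  have hsymm := (homeoSeries 𝕜 m).symm.continuous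
  have hchart := (homeoSeries 𝕜 m).continuous
  refine ⟨⟨(homeoSeries 𝕜 m).symm.t2Space, fun e he e' he' => ?_⟩, ⟨?_, fun e he e' he' => ?_⟩,
    ⟨?_, fun e he e' he' => ?_⟩⟩
  · -- The only change of charts is the identity.
    rw [eq_of_mem_atlas he, eq_of_mem_atlas he']
    convert hA (Series 𝕜 m m) (Word m × Fin m) (coordinate 𝕜 m m)
      (fun ν i => MvPolynomial.X (ν, i)) id hid using 1
    · rfl
    · exact eq_univ_of_forall fun _ => ⟨trivial, trivial⟩
  · exact hsymm.comp ((continuous_of_eval ℓ P hmul).comp (hchart.prodMap hchart))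
  · obtain ⟨e₁, he₁, e₂, he₂, rfl⟩ := he
    rw [eq_of_mem_atlas he₁, eq_of_mem_atlas he₂, eq_of_mem_atlas he']
    convert hA _ _ ℓ P mulChart hmul using 1
    · rfl
    · exact eq_univ_of_forall fun _ => ⟨⟨trivial, trivial⟩, trivial⟩
  · exact hsymm.comp ((continuous_of_eval _ Q hinv).comp hchart)
  · rw [eq_of_mem_atlas he, eq_of_mem_atlas he']
    convert hA _ _ _ Q invChart hinv using 1
    · rfl
    · exact eq_univ_of_forall fun _ => ⟨trivial, trivial⟩

end UnitalSeries

end LieGroup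

end ChenFliess

theorem mainTheorem2 (m : ℕ) :
    (∃ _ : Group (ChenFliess.UnitalSeries ℝ m),
      (∀ c d : ChenFliess.UnitalSeries ℝ m, c * d = ChenFliess.UnitalSeries.comp c d) ∧
      (1 : ChenFliess.UnitalSeries ℝ m) = ChenFliess.UnitalSeries.delta ∧
      ChenFliess.IsRealAnalyticLieGroup
        (ChenFliess.Series ℝ m m) (ChenFliess.UnitalSeries ℝ m) ∧
      ChenFliess.UnitalSeries.HasPolynomialOperations ℝ m) ∧
    (∃ _ : Group (ChenFliess.UnitalSeries ℂ m),
      (∀ c d : ChenFliess.UnitalSeries ℂ m, c * d = ChenFliess.UnitalSeries.comp c d) ∧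
      (1 : ChenFliess.UnitalSeries ℂ m) = ChenFliess.UnitalSeries.delta ∧
      ChenFliess.IsComplexAnalyticLieGroup
        (ChenFliess.Series ℂ m m) (ChenFliess.UnitalSeries ℂ m) ∧
      ChenFliess.UnitalSeries.HasPolynomialOperations ℂ m) := by
  refine ⟨⟨ChenFliess.UnitalSeries.groupStr ℝ m, fun _ _ => rfl, rfl, ?_,
      ChenFliess.UnitalSeries.hasPolynomialOperations ℝ m⟩,
    ⟨ChenFliess.UnitalSeries.groupStr ℂ m, fun _ _ => rfl, rfl, ?_,
      ChenFliess.UnitalSeries.hasPolynomialOperations ℂ m⟩⟩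
  · exact ChenFliess.UnitalSeries.isLieGroupOf ChenFliess.IsRealAnalyticOn
      fun _ _ _ _ _ ℓ P _ hf => ChenFliess.isRealAnalyticOn_of_eval ℓ P hf
  · exact ChenFliess.UnitalSeries.isLieGroupOf ChenFliess.IsComplexAnalyticOn
      fun _ _ _ _ _ ℓ P _ hf => ChenFliess.isComplexAnalyticOn_of_eval ℓ P hf
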